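/- Let $\mathbb D=\{z\in\mathbb C:|z|<1\}$ and $\gamma>0$. Let $H^\infty_{v_\gamma}$ be the space of holomorphic functions $f$ on $\mathbb D$ with $\|f\|:=\sup_{z\in\mathbb D}(1-|z|)^\gamma|f(z)|<\infty$, and let $H^0_{v_\gamma}$ be its subspace of those $f$ with $\lim_{|z|\to1^-}(1-|z|)^\gamma|f(z)|=0$, with the same norm. Let $\mu$ be a positive finite Borel measure on $[0,1)$ with $\mu((0,1))>0$, with moments $\mu_n=\int_{[0,1)}t^n\,d\mu(t)$, $n\ge 0$, and for $f(z)=\sum_{n\ge0}a_nz^n$ holomorphic on $\mathbb D$ put $$C_\mu(f)(z)=\sum_{n=0}^\infty\mu_n\Big(\sum_{k=0}^n a_k\Big)z^n,\qquad z\in\mathbb D.$$ Suppose that $\mu$ is a vanishing Carleson measure, that is, $\mu([t,1))=o(1-t)$ as $t\to1^-$. Then $C_\mu$ defines bounded linear operators $H^\infty_{v_\gamma}\to H^\infty_{v_\gamma}$ and $H^0_{v_\gamma}\to H^0_{v_\gamma}$, and their point spectra $\sigma_p$ (sets of eigenvalues) and spectra $\sigma$ are 1. $\sigma_p(C_\mu,H^\infty_{v_\gamma})=\sigma_p(C_\mu,H^0_{v_\gamma})=\{\mu_n:n\ge0\}$,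 2. $\sigma(C_\mu,H^\infty_{v_\gamma})=\sigma(C_\mu,H^0_{v_\gamma})=\{\mu_n:n\ge0\}\cup\{0\}$. In particular, this holds if $\mu$ is an $s$-Carleson measure for some $s>1$, that is, if there is a constant $C$ with $\mu([t,1))\le C(1-t)^s$ for all $0\le t<1$. -/

import Mathlib

open Set Filter Topology MeasureTheory Metric Asymptotics

namespace CesaroType

noncomputable section

/-! ### Measures on `[0,1)`

A positive finite Borel measure on `[0,1)` is a finite measure `μ` on `ℝ` with
`μ (Ico 0 1)ᶜ = 0`. -/

/-- The `n`-th moment `μ_n = ∫_{[0,1)} t ^ n dμ(t)`. -/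
def moment (μ : Measure ℝ) (n : ℕ) : ℝ := ∫ t in Ico (0 : ℝ) 1, t ^ n ∂μ

/-- `μ` is an `s`-Carleson measure: `μ([t,1)) = O((1-t)^s)`, `0 ≤ t < 1`. -/
def IsCarleson (s : ℝ) (μ : Measure ℝ) : Prop :=
  ∃ C : ℝ, ∀ t ∈ Ico (0 : ℝ) 1, μ.real (Ico t 1) ≤ C * (1 - t) ^ s

/-- `μ` is a vanishing `s`-Carleson measure: `μ([t,1)) = o((1-t)^s)` as `t → 1⁻`. A vanishing
Carleson measure is a vanishing `1`-Carleson measure. -/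
def IsVanishingCarleson (s : ℝ) (μ : Measure ℝ) : Prop :=
  (fun t : ℝ => μ.real (Ico t 1)) =o[𝓝[<] 1] fun t : ℝ => (1 - t) ^ s

/-! ### The growth spaces `H^∞_{v_γ}` and `H^0_{v_γ}` -/

/-- The standard weight `v_γ(z) = (1 - |z|) ^ γ`. -/
def weight (γ : ℝ) (z : ℂ) : ℝ := (1 - ‖z‖) ^ γ

/-- The holomorphic functions `f` on the open unit disc with `sup_{|z|<1} v_γ(z) |f(z)| < ∞`.
A function on the disc is represented by its extension by zero to `ℂ`. -/
def growthSubmodule (γ : ℝ) : Submodule ℂ (ℂ → ℂ) where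
  carrier := {f | DifferentiableOn ℂ f (ball 0 1) ∧ (∀ z ∉ ball (0 : ℂ) 1, f z = 0) ∧
    BddAbove (range fun z : ball (0 : ℂ) 1 => weight γ z * ‖f z‖)}
  zero_mem' := by
    refine ⟨differentiableOn_const 0, fun _ _ => rfl, 0, ?_⟩
    rintro _ ⟨z, rfl⟩
    simp
  add_mem' := by
    rintro f g ⟨hf, hf0, A, hA⟩ ⟨hg, hg0, B, hB⟩
    refine ⟨hf.add hg, fun z hz => by simp [hf0 z hz, hg0 z hz], A + B, ?_⟩
    rintro _ ⟨z, rfl⟩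
    have hz : ‖(z : ℂ)‖ < 1 := mem_ball_zero_iff.1 z.2
    have hw : 0 ≤ weight γ z := Real.rpow_nonneg (by linarith) _
    calc weight γ z * ‖(f + g) z‖ ≤ weight γ z * (‖f z‖ + ‖g z‖) :=
          mul_le_mul_of_nonneg_left (norm_add_le _ _) hw
      _ = weight γ z * ‖f z‖ + weight γ z * ‖g z‖ := mul_add _ _ _
      _ ≤ A + B := add_le_add (hA ⟨z, rfl⟩) (hB ⟨z, rfl⟩)
  smul_mem' := by
    rintro c f ⟨hf, hf0, A, hA⟩
    refine ⟨hf.const_smul c, fun z hz => by simp [hf0 z hz], ‖c‖ * A, ?_⟩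
    rintro _ ⟨z, rfl⟩
    calc weight γ z * ‖(c • f) z‖ = ‖c‖ * (weight γ z * ‖f z‖) := by
          simp only [Pi.smul_apply, smul_eq_mul, norm_mul]; ring
      _ ≤ ‖c‖ * A := mul_le_mul_of_nonneg_left (hA ⟨z, rfl⟩) (norm_nonneg c)

/-- The space `H^∞_{v_γ}` (with the norm defined below, not the topology of `ℂ → ℂ`). -/
def HInfty (γ : ℝ) : Type := growthSubmodule γ

instance (γ : ℝ) : AddCommGroup (HInfty γ) := inferInstanceAs (AddCommGroup (growthSubmodule γ))

instance (γ : ℝ) : Module ℂ (HInfty γ) := inferInstanceAs (Module ℂ (growthSubmodule γ))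

instance (γ : ℝ) : CoeFun (HInfty γ) (fun _ => ℂ → ℂ) := ⟨fun f => f.1⟩

/-- The norm `‖f‖ = sup_{|z|<1} v_γ(z) |f(z)|`. -/
instance (γ : ℝ) : Norm (HInfty γ) := ⟨fun f => ⨆ z : ball (0 : ℂ) 1, weight γ z * ‖f z‖⟩

theorem weight_pos (γ : ℝ) (z : ball (0 : ℂ) 1) : 0 < weight γ z := by
  have hz : ‖(z : ℂ)‖ < 1 := mem_ball_zero_iff.1 z.2
  exact Real.rpow_pos_of_pos (by linarith) _

theorem weight_mul_le_norm {γ : ℝ} (f : HInfty γ) (z : ball (0 : ℂ) 1) :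
    weight γ z * ‖f z‖ ≤ ‖f‖ :=
  le_ciSup (f := fun z : ball (0 : ℂ) 1 => weight γ z * ‖f z‖) f.2.2.2 z

theorem normedSpaceCore (γ : ℝ) : NormedSpace.Core ℂ (HInfty γ) where
  norm_nonneg f := Real.iSup_nonneg fun z => mul_nonneg (weight_pos γ z).le (norm_nonneg _)
  norm_smul c f := by
    change (⨆ z : ball (0 : ℂ) 1, weight γ z * ‖c * f z‖)
      = ‖c‖ * ⨆ z : ball (0 : ℂ) 1, weight γ z * ‖f z‖
    rw [Real.mul_iSup_of_nonneg (norm_nonneg c)]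
    congr 1
    ext z
    rw [norm_mul]
    ring
  norm_triangle f g := by
    have : Nonempty (ball (0 : ℂ) 1) := ⟨⟨0, by simp⟩⟩
    refine ciSup_le fun z => ?_
    calc weight γ z * ‖f z + g z‖ ≤ weight γ z * (‖f z‖ + ‖g z‖) :=
          mul_le_mul_of_nonneg_left (norm_add_le _ _) (weight_pos γ z).le
      _ = weight γ z * ‖f z‖ + weight γ z * ‖g z‖ := mul_add _ _ _
      _ ≤ ‖f‖ + ‖g‖ := add_le_add (weight_mul_le_norm f z) (weight_mul_le_norm g z)
  norm_eq_zero_iff f := by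
    constructor
    · intro h
      refine Subtype.ext (funext fun z => ?_)
      by_cases hz : z ∈ ball (0 : ℂ) 1
      · have h1 := weight_mul_le_norm f ⟨z, hz⟩
        rw [h] at h1
        have h2 := weight_pos γ ⟨z, hz⟩
        have h3 : ‖f z‖ ≤ 0 := by
          by_contra h4
          exact absurd h1 (not_le.2 (mul_pos h2 (not_le.1 h4)))
        exact norm_le_zero_iff.1 h3
      · exact f.2.2.1 z hz
    · rintro rfl
      change (⨆ z : ball (0 : ℂ) 1, weight γ z * ‖(0 : ℂ)‖) = 0
      simp

instance (γ : ℝ) : NormedAddCommGroup (HInfty γ) := NormedAddCommGroup.ofCore (normedSpaceCore γ)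

instance (γ : ℝ) : NormedSpace ℂ (HInfty γ) := NormedSpace.ofCore (normedSpaceCore γ)

/-- The subspace `H^0_{v_γ}` of those `f ∈ H^∞_{v_γ}` with `v_γ(z) |f(z)| → 0` as `|z| → 1⁻`,
with the norm of `H^∞_{v_γ}`. -/
def HZero (γ : ℝ) : Submodule ℂ (HInfty γ) where
  carrier := {f | Tendsto (fun z : ℂ => weight γ z * ‖f z‖) (comap norm (𝓝[<] (1 : ℝ))) (𝓝 0)}
  zero_mem' := by
    change Tendsto (fun z : ℂ => weight γ z * ‖(0 : ℂ)‖) _ _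
    simpa using tendsto_const_nhds
  add_mem' := by
    intro f g hf hg
    have h := Tendsto.add hf hg
    rw [add_zero] at h
    have hlt : ∀ᶠ z : ℂ in comap norm (𝓝[<] (1 : ℝ)), ‖z‖ < 1 :=
      tendsto_comap.eventually (p := fun r : ℝ => r < 1) self_mem_nhdsWithin
    refine squeeze_zero' ?_ ?_ h
    · filter_upwards [hlt] with z hz
      exact mul_nonneg (Real.rpow_nonneg (by linarith) _) (norm_nonneg _)
    · filter_upwards [hlt] with z hz
      rw [← mul_add]
      exact mul_le_mul_of_nonneg_left (norm_add_le _ _) (Real.rpow_nonneg (by linarith) _)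
  smul_mem' := by
    intro c f hf
    have h := Tendsto.const_mul ‖c‖ hf
    rw [mul_zero] at h
    refine h.congr fun z => ?_
    change _ = weight γ z * ‖c * f z‖
    rw [norm_mul]
    ring

/-! ### The Cesàro-type operator -/

/-- The `k`-th Taylor coefficient of `f` at `0`. -/
def taylorCoeff (f : ℂ → ℂ) (k : ℕ) : ℂ := iteratedDeriv k f 0 / (k.factorial : ℂ)

/-- The function `C_μ(f)(z) = ∑_n μ_n (∑_{k ≤ n} a_k) z ^ n`, `|z| < 1`, where
`f(z) = ∑_n a_n z ^ n` is holomorphic on the open unit disc. -/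
def cesaro (μ : Measure ℝ) (f : ℂ → ℂ) (z : ℂ) : ℂ :=
  ∑' n : ℕ, (moment μ n : ℂ) * (∑ k ∈ Finset.range (n + 1), taylorCoeff f k) * z ^ n

theorem abs_moment_le (μ : Measure ℝ) [IsFiniteMeasure μ] (n : ℕ) :
    |moment μ n| ≤ μ.real (Ico (0 : ℝ) 1) := by
  have h := norm_setIntegral_le_of_norm_le_const (μ := μ) (s := Ico (0 : ℝ) 1)
    (f := fun t : ℝ => t ^ n) (C := 1) (measure_lt_top μ _) fun t ht => by
      rw [Real.norm_eq_abs, abs_of_nonneg (pow_nonneg ht.1 n)]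
      exact pow_le_one₀ ht.1 ht.2.le
  simpa [moment] using h

/-- The series defining `C_μ(f)` converges absolutely on the open unit disc. -/
theorem summable_norm_cesaro (μ : Measure ℝ) [IsFiniteMeasure μ] {f : ℂ → ℂ}
    (hf : DifferentiableOn ℂ f (ball 0 1)) {z : ℂ} (hz : z ∈ ball (0 : ℂ) 1) :
    Summable fun n : ℕ =>
      ‖(moment μ n : ℂ) * (∑ k ∈ Finset.range (n + 1), taylorCoeff f k) * z ^ n‖ := by
  have hz1 : ‖z‖ < 1 := mem_ball_zero_iff.1 hz
  have h1 : Summable fun n : ℕ => ‖taylorCoeff f n * z ^ n‖ := by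
    have h := (Complex.hasSum_taylorSeries_on_ball (r := 1) hf hz).summable.norm
    refine h.congr fun n => ?_
    simp only [taylorCoeff, sub_zero, smul_eq_mul, norm_mul, norm_div, norm_inv]
    ring
  have h2 : Summable fun n : ℕ => ‖z ^ n‖ := by
    simpa [norm_pow] using summable_geometric_of_lt_one (norm_nonneg z) hz1
  have h3 := (summable_norm_sum_mul_range_of_summable_norm h1 h2).mul_left
    (μ.real (Ico (0 : ℝ) 1))
  refine Summable.of_nonneg_of_le (fun _ => norm_nonneg _) (fun n => ?_) h3
  have h4 : ∑ k ∈ Finset.range (n + 1), taylorCoeff f k * z ^ k * z ^ (n - k)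
      = (∑ k ∈ Finset.range (n + 1), taylorCoeff f k) * z ^ n := by
    rw [Finset.sum_mul]
    refine Finset.sum_congr rfl fun k hk => ?_
    rw [mul_assoc, ← pow_add, Nat.add_sub_cancel' (Nat.lt_succ_iff.1 (Finset.mem_range.1 hk))]
  rw [h4, mul_assoc, norm_mul]
  refine mul_le_mul_of_nonneg_right ?_ (norm_nonneg _)
  simpa using abs_moment_le μ n

/-! ### Point spectrum -/

/-- The point spectrum (set of eigenvalues) of a continuous linear operator. -/
def pointSpectrum {X : Type*} [NormedAddCommGroup X] [NormedSpace ℂ X] (T : X →L[ℂ] X) : Set ℂ :=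
  {l | Module.End.HasEigenvalue (T : X →ₗ[ℂ] X) l}

end

end CesaroType

open CesaroType

/-! The operator is compact, and on Taylor coefficients it is lower triangular with diagonal `μ_n`;
these two facts determine both spectra.

Compactness: cut `μ` at some `ρ < 1`. The moments of the part on `[0,ρ)` are `O(ρ ^ n)`, so its
operator is a norm-convergent sum of rank-one operators with monomial values
(`summable_cesaroTerm`); it is compact with range in `H^0`. For the part on `[ρ,1)`, write `C_ν f(z)
= ∫ f(tz)/(1-tz) dν(t)`; a layer-cake comparison with Lebesgue measure bounds the norm by a constant
times the Carleson constant of `ν` (`weight_mul_norm_cesaro_le`), which is small for `ρ` near `1`.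
So `C_μ` is a norm limit of compact operators with range in the closed subspace `H^0`.

Spectra: the moments are nonzero, distinct and tend to `0`. Triangularity forces every eigenvalue
onto the diagonal and keeps `z ^ m` out of the range of `μ_m - C_μ`, so each `μ_m` lies in the
spectrum. The Fredholm alternative makes it an eigenvalue, and `0` is in the spectrum as a limit
(`spectra_of_triangular`). The same argument applies to both spaces. -/

open CesaroType

/-! ### Spectra of compact triangular operators -/

section Triangular

variable {X : Type*} [NormedAddCommGroup X] [NormedSpace ℂ X]

/-- Forward substitution: once the earlier coefficients vanish, the `n`-th equation is `(c n - l) *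
a n x = 0`. The cutoff `N` serves both genuine eigenvectors and equations that hold only below one
index. -/
theorem coeff_eq_zero_of_triangular_eigen {T : X →L[ℂ] X} {c : ℕ → ℂ} {a : ℕ → X →ₗ[ℂ] ℂ}
    (hTa : ∀ x n, a n (T x) = c n * ∑ k ∈ Finset.range (n + 1), a k x) {x : X} {l : ℂ} {N : ℕ}
    (hx : ∀ n < N, a n (T x) = l * a n x) (hl : ∀ n < N, c n ≠ l) :
    ∀ n < N, a n x = 0 := by
  intro n
  induction n using Nat.strong_induction_on with
  | _ n ih =>
    intro hn
    have h := hx n hn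
    rw [hTa, Finset.sum_range_succ, Finset.sum_eq_zero, zero_add] at h
    · have : (c n - l) * a n x = 0 := by rw [sub_mul, h, sub_self]
      exact (mul_eq_zero.1 this).resolve_left (sub_ne_zero.2 (hl n hn))
    · intro k hk
      have hk' := Finset.mem_range.1 hk
      exact ih k hk' (hk'.trans hn)

/-- The spectra of a compact operator that acts on the coefficients of a vector by
`(a n) ↦ (c n * ∑ k ≤ n, a k)`. -/
theorem spectra_of_triangular [CompleteSpace X] {T : X →L[ℂ] X} (hT : IsCompactOperator T)
    {c : ℕ → ℂ} (hc0 : ∀ n, c n ≠ 0) (hinj : Function.Injective c)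
    (hlim : Tendsto c atTop (𝓝 0)) {a : ℕ → X →ₗ[ℂ] ℂ}
    (hsep : ∀ x, (∀ n, a n x = 0) → x = 0)
    (hTa : ∀ x n, a n (T x) = c n * ∑ k ∈ Finset.range (n + 1), a k x)
    {e : ℕ → X} (he : ∀ m n, a n (e m) = if n = m then 1 else 0) :
    pointSpectrum T = range c ∧ spectrum ℂ T = range c ∪ {0} := by
  -- If `(c m - T) x = e m`, the coefficients of `x` below `m` vanish, and the `m`-th equation then
  -- reads `0 = 1`.
  have hspec : ∀ m, c m ∈ spectrum ℂ T := by
    intro m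
    rw [spectrum.mem_iff, ContinuousLinearMap.isUnit_iff_bijective]
    rintro ⟨-, hs⟩
    obtain ⟨x, hx⟩ := hs (e m)
    have hx' : ∀ n, c m * a n x - a n (T x) = if n = m then 1 else 0 := by
      intro n
      rw [← he m n, ← hx]
      simp [Algebra.algebraMap_eq_smul_one]
    have h0 : ∀ n < m, a n x = 0 := by
      refine coeff_eq_zero_of_triangular_eigen hTa (l := c m) (fun n hn => ?_) fun n hn => ?_
      · have := hx' n
        rw [if_neg hn.ne] at this
        exact (sub_eq_zero.1 this).symm
      · exact fun h => hn.ne (hinj h)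
    have := hx' m
    rw [hTa, Finset.sum_range_succ, Finset.sum_eq_zero, zero_add, sub_self, if_pos rfl] at this
    · exact zero_ne_one this
    · exact fun k hk => h0 k (Finset.mem_range.1 hk)
  have heig : ∀ l, Module.End.HasEigenvalue (T : X →ₗ[ℂ] X) l → l ∈ range c := by
    intro l hl
    obtain ⟨x, hx⟩ := hl.exists_hasEigenvector
    by_contra hlc
    refine hx.2 (hsep x fun n => ?_)
    refine coeff_eq_zero_of_triangular_eigen hTa (l := l) (N := n + 1) (fun k _ => ?_)
      (fun k _ h => hlc ⟨k, h⟩) n n.lt_succ_self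
    have : T x = l • x := hx.apply_eq_smul
    rw [this, map_smul, smul_eq_mul]
  refine ⟨Subset.antisymm heig ?_, Subset.antisymm (fun l hl => ?_) ?_⟩
  · rintro _ ⟨m, rfl⟩
    -- Fredholm alternative: a nonzero spectral value of a compact operator is an eigenvalue.
    exact (hT.hasEigenvalue_iff_mem_spectrum (hc0 m)).2 (hspec m)
  · by_cases h0 : l = 0
    · exact Or.inr h0
    · exact Or.inl (heig l ((hT.hasEigenvalue_iff_mem_spectrum h0).2 hl))
  · rintro _ (⟨m, rfl⟩ | rfl)
    · exact hspec m
    · exact (spectrum.isClosed T).mem_of_tendsto hlim (Eventually.of_forall hspec)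

end Triangular

/-! ### Taylor coefficients of sums of power series on the disc -/

section Taylor

theorem hasSum_taylorCoeff {f : ℂ → ℂ} (hf : DifferentiableOn ℂ f (ball 0 1)) {z : ℂ}
    (hz : z ∈ ball (0 : ℂ) 1) : HasSum (fun n => taylorCoeff f n * z ^ n) (f z) := by
  refine (Complex.hasSum_taylorSeries_on_ball hf hz).congr_fun fun n => ?_
  simp only [taylorCoeff, sub_zero, smul_eq_mul]
  ring

theorem hasFPowerSeriesAt_of_hasSum {f : ℂ → ℂ} {b : ℕ → ℂ}
    (h : ∀ z ∈ ball (0 : ℂ) 1, HasSum (fun n => b n * z ^ n) (f z)) :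
    HasFPowerSeriesAt f (FormalMultilinearSeries.ofScalars ℂ b) 0 := by
  rw [hasFPowerSeriesAt_iff]
  filter_upwards [ball_mem_nhds (0 : ℂ) one_pos] with z hz
  simpa [FormalMultilinearSeries.coeff_ofScalars, mul_comm] using h z hz

theorem taylorCoeff_eq_of_hasSum {f : ℂ → ℂ} {b : ℕ → ℂ}
    (h : ∀ z ∈ ball (0 : ℂ) 1, HasSum (fun n => b n * z ^ n) (f z)) (n : ℕ) :
    taylorCoeff f n = b n := by
  have h1 := hasFPowerSeriesAt_of_hasSum h
  have h2 := h1.analyticAt.hasFPowerSeriesAt.eq_formalMultilinearSeries h1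
  have h3 := congrArg (fun p : FormalMultilinearSeries ℂ ℂ ℂ => p.coeff n) h2
  simpa [FormalMultilinearSeries.coeff_ofScalars, taylorCoeff] using h3

theorem differentiableOn_of_hasSum {f : ℂ → ℂ} {b : ℕ → ℂ}
    (h : ∀ z ∈ ball (0 : ℂ) 1, HasSum (fun n => b n * z ^ n) (f z)) :
    DifferentiableOn ℂ f (ball 0 1) := by
  have hr : 1 ≤ (FormalMultilinearSeries.ofScalars ℂ b).radius := by
    refine ENNReal.le_of_forall_nnreal_lt fun r hr => ?_
    have hr1 : (r : ℝ) < 1 := by exact_mod_cast hr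
    refine FormalMultilinearSeries.le_radius_of_tendsto (l := 0) _ ?_
    have h1 := (h (r : ℂ) (by simpa using hr1)).summable.tendsto_atTop_zero.norm
    simpa [FormalMultilinearSeries.ofScalars_norm] using h1
  have h2 : HasFPowerSeriesOnBall f (FormalMultilinearSeries.ofScalars ℂ b) 0 1 := by
    refine ⟨hr, one_pos, fun {y} hy => ?_⟩
    have hy' : y ∈ ball (0 : ℂ) 1 := by
      rw [← ENNReal.ofReal_one, Metric.eball_ofReal] at hy
      exact hy
    simpa [FormalMultilinearSeries.ofScalars_apply_eq, mul_comm] using h y hy'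
  have := h2.differentiableOn
  rwa [← ENNReal.ofReal_one, Metric.eball_ofReal] at this

end Taylor

/-! ### Bounded functionals, completeness of `H^∞`, closedness of `H^0` -/

section Growth

variable {γ : ℝ}

theorem HInfty.ext {f g : HInfty γ} (h : ∀ z ∈ ball (0 : ℂ) 1, f z = g z) : f = g := by
  refine Subtype.ext (funext fun z => ?_)
  by_cases hz : z ∈ ball (0 : ℂ) 1
  · exact h z hz
  · rw [f.2.2.1 z hz, g.2.2.1 z hz]

theorem HInfty.norm_apply_le (f : HInfty γ) {z : ℂ} (hz : z ∈ ball (0 : ℂ) 1) :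
    ‖f z‖ ≤ (1 - ‖z‖) ^ (-γ) * ‖f‖ := by
  have hz1 : 0 < 1 - ‖z‖ := by linarith [mem_ball_zero_iff.1 hz]
  have h := weight_mul_le_norm f ⟨z, hz⟩
  rw [Real.rpow_neg hz1.le, inv_mul_eq_div, le_div_iff₀' (Real.rpow_pos_of_pos hz1 _)]
  exact h

theorem HInfty.norm_le {f : HInfty γ} {C : ℝ}
    (h : ∀ z ∈ ball (0 : ℂ) 1, weight γ z * ‖f z‖ ≤ C) : ‖f‖ ≤ C := by
  have : Nonempty (ball (0 : ℂ) 1) := ⟨⟨0, by simp⟩⟩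
  exact ciSup_le fun z => h z z.2

/-- The element of `H^∞_{v_γ}` that agrees with `f` on the unit disc. -/
noncomputable def HInfty.mk (f : ℂ → ℂ) (hf : DifferentiableOn ℂ f (ball 0 1)) (C : ℝ)
    (hC : ∀ z ∈ ball (0 : ℂ) 1, weight γ z * ‖f z‖ ≤ C) : HInfty γ :=
  ⟨(ball (0 : ℂ) 1).indicator f, hf.congr fun z hz => indicator_of_mem hz f,
    fun z hz => indicator_of_notMem hz f, C, by
      rintro _ ⟨z, rfl⟩
      simpa only [indicator_of_mem z.2] using hC z z.2⟩

theorem HInfty.mk_apply {f : ℂ → ℂ} {hf : DifferentiableOn ℂ f (ball 0 1)} {C : ℝ}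
    {hC : ∀ z ∈ ball (0 : ℂ) 1, weight γ z * ‖f z‖ ≤ C} {z : ℂ} (hz : z ∈ ball (0 : ℂ) 1) :
    HInfty.mk f hf C hC z = f z :=
  indicator_of_mem hz f

theorem HInfty.taylorCoeff_eq_zero {f : HInfty γ} (h : ∀ n, taylorCoeff f n = 0) : f = 0 := by
  refine HInfty.ext fun z hz => ?_
  have h1 := hasSum_taylorCoeff f.2.1 hz
  simp only [h, zero_mul] at h1
  exact h1.unique hasSum_zero

theorem taylorCoeff_hInfty_add (f g : HInfty γ) (n : ℕ) :
    taylorCoeff (f + g : HInfty γ) n = taylorCoeff f n + taylorCoeff g n := by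
  refine taylorCoeff_eq_of_hasSum (b := fun n => taylorCoeff f n + taylorCoeff g n)
    (fun z hz => ?_) n
  simpa only [add_mul] using! (hasSum_taylorCoeff f.2.1 hz).add (hasSum_taylorCoeff g.2.1 hz)

theorem taylorCoeff_hInfty_smul (c : ℂ) (f : HInfty γ) (n : ℕ) :
    taylorCoeff (c • f : HInfty γ) n = c * taylorCoeff f n := by
  refine taylorCoeff_eq_of_hasSum (b := fun n => c * taylorCoeff f n) (fun z hz => ?_) n
  simpa only [mul_assoc] using! (hasSum_taylorCoeff f.2.1 hz).mul_left c

/-- Cauchy's estimate on the circle of radius `R`. The radius stays free so that it can later be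
taken close to `1`. -/
theorem norm_taylorCoeff_le (f : HInfty γ) (n : ℕ) {R : ℝ} (hR : 0 < R) (hR1 : R < 1) :
    ‖taylorCoeff f n‖ ≤ (1 - R) ^ (-γ) * R⁻¹ ^ n * ‖f‖ := by
  have hsub : closedBall (0 : ℂ) R ⊆ ball 0 1 := closedBall_subset_ball hR1
  have hd : DiffContOnCl ℂ f (ball 0 R) := by
    refine DifferentiableOn.diffContOnCl ?_
    rw [closure_ball _ hR.ne']
    exact f.2.1.mono hsub
  have h := Complex.norm_iteratedDeriv_le_of_forall_mem_sphere_norm_le n hR hd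
    (C := (1 - R) ^ (-γ) * ‖f‖) fun z hz => by
      have := HInfty.norm_apply_le f (hsub (sphere_subset_closedBall hz))
      rwa [mem_sphere_zero_iff_norm.1 hz] at this
  have hn : (0 : ℝ) < n.factorial := by positivity
  rw [taylorCoeff, norm_div, Complex.norm_natCast, div_le_iff₀ hn]
  refine h.trans_eq ?_
  rw [inv_pow]
  ring

/-- The `n`-th Taylor coefficient as a bounded functional on `H^∞_{v_γ}`. -/
noncomputable def taylorCoeffCLM (γ : ℝ) (n : ℕ) : HInfty γ →L[ℂ] ℂ :=
  LinearMap.mkContinuous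
    { toFun := fun f => taylorCoeff f n
      map_add' := fun f g => taylorCoeff_hInfty_add f g n
      map_smul' := fun c f => taylorCoeff_hInfty_smul c f n }
    ((1 - 2⁻¹) ^ (-γ) * (2⁻¹)⁻¹ ^ n)
    fun f => norm_taylorCoeff_le f n (by norm_num) (by norm_num)

@[simp]
theorem taylorCoeffCLM_apply (n : ℕ) (f : HInfty γ) :
    taylorCoeffCLM γ n f = taylorCoeff f n := rfl

theorem norm_taylorCoeffCLM_le (n : ℕ) {R : ℝ} (hR : 0 < R) (hR1 : R < 1) :
    ‖taylorCoeffCLM γ n‖ ≤ (1 - R) ^ (-γ) * R⁻¹ ^ n := by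
  have : 0 < 1 - R := by linarith
  exact ContinuousLinearMap.opNorm_le_bound _ (by positivity)
    fun f => norm_taylorCoeff_le f n hR hR1

/-- Evaluation at a point of the disc as a bounded functional on `H^∞_{v_γ}`. -/
noncomputable def evalCLM (γ : ℝ) {z : ℂ} (hz : z ∈ ball (0 : ℂ) 1) : HInfty γ →L[ℂ] ℂ :=
  LinearMap.mkContinuous
    { toFun := fun f => f z
      map_add' := fun _ _ => rfl
      map_smul' := fun _ _ => rfl }
    ((1 - ‖z‖) ^ (-γ)) fun f => HInfty.norm_apply_le f hz

@[simp]
theorem evalCLM_apply {z : ℂ} (hz : z ∈ ball (0 : ℂ) 1) (f : HInfty γ) :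
    evalCLM γ hz f = f z := rfl

theorem HInfty.sub_apply (f g : HInfty γ) (z : ℂ) : (f - g : HInfty γ) z = f z - g z := rfl

theorem weight_nonneg {z : ℂ} (hz : z ∈ ball (0 : ℂ) 1) : 0 ≤ weight γ z :=
  (weight_pos γ ⟨z, hz⟩).le

theorem weight_le_one (hγ : 0 ≤ γ) {z : ℂ} (hz : z ∈ ball (0 : ℂ) 1) : weight γ z ≤ 1 :=
  Real.rpow_le_one (by linarith [mem_ball_zero_iff.1 hz]) (by linarith [norm_nonneg z]) hγ

instance : CompleteSpace (HInfty γ) := by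
  refine Metric.complete_of_cauchySeq_tendsto fun u hu => ?_
  have hpt : ∀ z : ℂ, ∃ l, Tendsto (fun n => u n z) atTop (𝓝 l) := by
    intro z
    by_cases hz : z ∈ ball (0 : ℂ) 1
    · exact cauchySeq_tendsto_of_complete (hu.map (evalCLM γ hz).uniformContinuous)
    · exact ⟨0, by simpa only [(u _).2.2.1 z hz] using! tendsto_const_nhds⟩
  choose g hg using hpt
  obtain ⟨M, hM⟩ := hu.norm_bddAbove
  have hbound : ∀ z ∈ ball (0 : ℂ) 1, weight γ z * ‖g z‖ ≤ M := fun z hz =>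
    le_of_tendsto ((hg z).norm.const_mul _) (Eventually.of_forall fun n =>
      (weight_mul_le_norm (u n) ⟨z, hz⟩).trans (hM ⟨n, rfl⟩))
  have hclose : ∀ ε > 0, ∃ N, ∀ n ≥ N, ∀ z ∈ ball (0 : ℂ) 1, weight γ z * ‖u n z - g z‖ ≤ ε := by
    intro ε hε
    obtain ⟨N, hN⟩ := Metric.cauchySeq_iff.1 hu ε hε
    refine ⟨N, fun n hn z hz => ?_⟩
    refine le_of_tendsto (((tendsto_const_nhds.sub (hg z)).norm).const_mul _) ?_
    filter_upwards [eventually_ge_atTop N] with m hm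
    have h1 := hN n hn m hm
    rw [dist_eq_norm] at h1
    exact (weight_mul_le_norm (u n - u m) ⟨z, hz⟩).trans h1.le
  have hdiff : DifferentiableOn ℂ g (ball 0 1) := by
    refine TendstoLocallyUniformlyOn.differentiableOn (F := fun n => (u n : ℂ → ℂ)) (φ := atTop)
      ?_ (Eventually.of_forall fun n => (u n).2.1) isOpen_ball
    rw [tendstoLocallyUniformlyOn_iff_forall_isCompact isOpen_ball]
    intro K hK hKc
    rw [Metric.tendstoUniformlyOn_iff]
    intro ε hε
    -- On a compact subset of the disc the weight is bounded below, so closeness in the weighted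
    -- norm gives uniform closeness there.
    obtain ⟨δ, hδ, hKδ⟩ : ∃ δ > 0, ∀ z ∈ K, δ ≤ weight γ z := by
      rcases K.eq_empty_or_nonempty with rfl | hne
      · exact ⟨1, one_pos, by simp⟩
      · have hcont : ContinuousOn (weight γ) K := by
          refine ContinuousOn.rpow_const (by fun_prop) fun z hz => Or.inl ?_
          have := mem_ball_zero_iff.1 (hK hz)
          exact (by linarith : (0 : ℝ) < 1 - ‖z‖).ne'
        obtain ⟨z₀, hz₀, hmin⟩ := hKc.exists_isMinOn hne hcont
        exact ⟨weight γ z₀, weight_pos γ ⟨z₀, hK hz₀⟩, fun z hz => hmin hz⟩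
    obtain ⟨N, hN⟩ := hclose (δ * (ε / 2)) (by positivity)
    filter_upwards [eventually_ge_atTop N] with n hn z hz
    rw [dist_comm, dist_eq_norm]
    have h1 : δ * ‖u n z - g z‖ ≤ δ * (ε / 2) :=
      (mul_le_mul_of_nonneg_right (hKδ z hz) (norm_nonneg _)).trans (hN n hn z (hK hz))
    have h2 := le_of_mul_le_mul_left h1 hδ
    linarith
  refine ⟨HInfty.mk g hdiff M hbound, ?_⟩
  rw [Metric.tendsto_atTop]
  intro ε hε
  obtain ⟨N, hN⟩ := hclose (ε / 2) (by positivity)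
  refine ⟨N, fun n hn => ?_⟩
  rw [dist_eq_norm]
  refine lt_of_le_of_lt (HInfty.norm_le (C := ε / 2) fun z hz => ?_) (by linarith)
  rw [HInfty.sub_apply, HInfty.mk_apply hz]
  exact hN n hn z hz

theorem mem_hZero_iff {f : HInfty γ} : f ∈ HZero γ ↔
    Tendsto (fun z : ℂ => weight γ z * ‖f z‖) (comap norm (𝓝[<] (1 : ℝ))) (𝓝 0) := Iff.rfl

theorem eventually_mem_ball_comap_norm :
    ∀ᶠ z : ℂ in comap norm (𝓝[<] (1 : ℝ)), z ∈ ball (0 : ℂ) 1 := by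
  filter_upwards [tendsto_comap.eventually (p := fun r : ℝ => r < 1) self_mem_nhdsWithin]
    with z hz using mem_ball_zero_iff.2 hz

theorem isClosed_hZero : IsClosed (HZero γ : Set (HInfty γ)) := by
  refine isClosed_of_closure_subset fun f hf => ?_
  change f ∈ HZero γ
  rw [mem_hZero_iff, Metric.tendsto_nhds]
  intro ε hε
  obtain ⟨g, hg, hfg⟩ := Metric.mem_closure_iff.1 hf (ε / 2) (by positivity)
  have hg' := Metric.tendsto_nhds.1 (mem_hZero_iff.1 hg) (ε / 2) (by positivity)
  filter_upwards [hg', eventually_mem_ball_comap_norm] with z hz hzb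
  have hw : 0 ≤ weight γ z := weight_nonneg hzb
  rw [Real.dist_0_eq_abs, abs_of_nonneg (by positivity)] at hz ⊢
  have h1 := weight_mul_le_norm (f - g) ⟨z, hzb⟩
  rw [dist_eq_norm] at hfg
  rw [HInfty.sub_apply] at h1
  have h2 : ‖f z‖ ≤ ‖f z - g z‖ + ‖g z‖ := by
    simpa using norm_add_le (f z - g z) (g z)
  have h3 := mul_le_mul_of_nonneg_left h2 hw
  rw [mul_add] at h3
  simp only at h1
  linarith

instance : CompleteSpace (HZero γ) := isClosed_hZero.completeSpace_coe

end Growth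

/-! ### Monomials in `H^0` -/

section Monomial

variable {γ : ℝ}

/-- The function `z ^ n` as an element of `H^∞_{v_γ}`. -/
noncomputable def monomialH (hγ : 0 ≤ γ) (n : ℕ) : HInfty γ :=
  HInfty.mk (fun z => z ^ n) (by fun_prop) 1 fun z hz => by
    rw [norm_pow]
    exact mul_le_one₀ (weight_le_one hγ hz) (by positivity)
      (pow_le_one₀ (norm_nonneg z) (mem_ball_zero_iff.1 hz).le)

theorem monomialH_apply (hγ : 0 ≤ γ) (n : ℕ) {z : ℂ} (hz : z ∈ ball (0 : ℂ) 1) :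
    monomialH hγ n z = z ^ n := HInfty.mk_apply hz

theorem norm_monomialH_le (hγ : 0 ≤ γ) (n : ℕ) : ‖monomialH hγ n‖ ≤ 1 :=
  HInfty.norm_le fun z hz => by
    rw [monomialH_apply hγ n hz, norm_pow]
    exact mul_le_one₀ (weight_le_one hγ hz) (by positivity)
      (pow_le_one₀ (norm_nonneg z) (mem_ball_zero_iff.1 hz).le)

theorem taylorCoeff_monomialH (hγ : 0 ≤ γ) (m n : ℕ) :
    taylorCoeff (monomialH hγ m) n = if n = m then 1 else 0 := by
  refine taylorCoeff_eq_of_hasSum (b := fun n => if n = m then 1 else 0) (fun z hz => ?_) n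
  rw [monomialH_apply hγ m hz]
  have h := hasSum_single (f := fun n => (if n = m then (1 : ℂ) else 0) * z ^ n) m
    fun n hn => by simp [hn]
  simpa using h

theorem monomialH_mem_hZero (hγ : 0 < γ) (n : ℕ) : monomialH hγ.le n ∈ HZero γ := by
  have hw : Tendsto (weight γ) (comap norm (𝓝[<] (1 : ℝ))) (𝓝 0) := by
    have h1 : Tendsto (fun z : ℂ => ‖z‖) (comap norm (𝓝[<] (1 : ℝ))) (𝓝 1) :=
      tendsto_comap.mono_right nhdsWithin_le_nhds
    have h2 : Tendsto (fun r : ℝ => (1 - r) ^ γ) (𝓝 1) (𝓝 0) := by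
      have : ContinuousAt (fun r : ℝ => (1 - r) ^ γ) 1 :=
        ContinuousAt.rpow_const (by fun_prop) (Or.inr hγ.le)
      simpa [ContinuousAt, Real.zero_rpow hγ.ne'] using this
    exact h2.comp h1
  refine squeeze_zero' ?_ ?_ hw
  · filter_upwards [eventually_mem_ball_comap_norm] with z hz
    exact mul_nonneg (weight_nonneg hz) (norm_nonneg _)
  · filter_upwards [eventually_mem_ball_comap_norm] with z hz
    rw [monomialH_apply hγ.le n hz, norm_pow]
    exact mul_le_of_le_one_right (weight_nonneg hz)
      (pow_le_one₀ (norm_nonneg z) (mem_ball_zero_iff.1 hz).le)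

end Monomial

/-! ### Norm-convergent series of rank-one operators -/

section RankOne

variable {γ : ℝ}

/-- The rank one operator `f ↦ c * (∑ k ≤ n, a k) z ^ n`, where `f = ∑ a k z ^ k`. -/
noncomputable def cesaroTerm (hγ : 0 ≤ γ) (c : ℂ) (n : ℕ) : HInfty γ →L[ℂ] HInfty γ :=
  (c • ∑ k ∈ Finset.range (n + 1), taylorCoeffCLM γ k).smulRight (monomialH hγ n)

theorem cesaroTerm_apply (hγ : 0 ≤ γ) (c : ℂ) (n : ℕ) (f : HInfty γ) :
    cesaroTerm hγ c n f =
      (c * ∑ k ∈ Finset.range (n + 1), taylorCoeff f k) • monomialH hγ n := by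
  simp [cesaroTerm]

theorem isCompactOperator_cesaroTerm (hγ : 0 ≤ γ) (c : ℂ) (n : ℕ) :
    IsCompactOperator (cesaroTerm hγ c n) :=
  (isCompactOperator_of_locallyCompactSpace_rng
    (ContinuousLinearMap.toSpanSingleton ℂ (monomialH hγ n))).comp_clm
    (c • ∑ k ∈ Finset.range (n + 1), taylorCoeffCLM γ k)

theorem norm_cesaroTerm_le (hγ : 0 ≤ γ) (c : ℂ) (n : ℕ) {R : ℝ} (hR : 0 < R) (hR1 : R < 1) :
    ‖cesaroTerm hγ c n‖ ≤ ‖c‖ * ((n + 1) * ((1 - R) ^ (-γ) * R⁻¹ ^ n)) := by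
  have h1R : 0 < 1 - R := by linarith
  rw [cesaroTerm, ContinuousLinearMap.norm_smulRight_apply, norm_smul]
  refine (mul_le_of_le_one_right (by positivity) (norm_monomialH_le hγ n)).trans ?_
  refine mul_le_mul_of_nonneg_left ?_ (norm_nonneg c)
  refine (norm_sum_le _ _).trans ?_
  have h := Finset.sum_le_card_nsmul (Finset.range (n + 1)) (fun k => ‖taylorCoeffCLM γ k‖)
    ((1 - R) ^ (-γ) * R⁻¹ ^ n) fun k hk => (norm_taylorCoeffCLM_le k hR hR1).trans <|
      mul_le_mul_of_nonneg_left (pow_le_pow_right₀ (one_le_inv_iff₀.2 ⟨hR, hR1.le⟩)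
        (Nat.lt_succ_iff.1 (Finset.mem_range.1 hk))) (by positivity)
  simpa using h

theorem summable_cesaroTerm (hγ : 0 ≤ γ) {c : ℕ → ℂ} {M ρ : ℝ} (hρ0 : 0 < ρ) (hρ : ρ < 1)
    (hc : ∀ n, ‖c n‖ ≤ M * ρ ^ n) : Summable fun n => cesaroTerm hγ (c n) n := by
  -- Cauchy's estimate at radius `R` costs `(n + 1) * R⁻¹ ^ n`; with `ρ < R` the decay of `c n`
  -- wins.
  obtain ⟨R, hρR, hR1⟩ := exists_between hρ
  have hR : 0 < R := hρ0.trans hρR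
  have h1R : 0 < 1 - R := by linarith
  have hq : ‖ρ / R‖ < 1 := by
    rw [Real.norm_of_nonneg (by positivity)]
    exact (div_lt_one hR).2 hρR
  have hs : Summable fun n : ℕ => ((n : ℝ) + 1) * (ρ / R) ^ n := by
    have h1 := summable_pow_mul_geometric_of_norm_lt_one 1 hq
    have h2 := summable_geometric_of_norm_lt_one hq
    simpa [add_mul] using h1.add h2
  refine Summable.of_norm_bounded (hs.mul_left (M * (1 - R) ^ (-γ))) fun n => ?_
  refine (norm_cesaroTerm_le hγ (c n) n hR hR1).trans ?_
  refine (mul_le_mul_of_nonneg_right (hc n) (by positivity)).trans_eq ?_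
  rw [div_pow, inv_pow]
  field_simp

theorem tsum_cesaroTerm_apply (hγ : 0 ≤ γ) {c : ℕ → ℂ}
    (hs : Summable fun n => cesaroTerm hγ (c n) n) (f : HInfty γ) {z : ℂ}
    (hz : z ∈ ball (0 : ℂ) 1) :
    (∑' n, cesaroTerm hγ (c n) n) f z
      = ∑' n, c n * (∑ k ∈ Finset.range (n + 1), taylorCoeff f k) * z ^ n := by
  have h1 := (hs.hasSum.mapL (ContinuousLinearMap.apply ℂ (HInfty γ) f)).mapL (evalCLM γ hz)
  refine h1.tsum_eq.symm.trans (tsum_congr fun n => ?_)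
  rw [ContinuousLinearMap.apply_apply, cesaroTerm_apply, map_smul, evalCLM_apply,
    monomialH_apply hγ n hz, smul_eq_mul]

theorem tsum_cesaroTerm_mem_hZero (hγ : 0 < γ) {c : ℕ → ℂ}
    (hs : Summable fun n => cesaroTerm hγ.le (c n) n) (f : HInfty γ) :
    (∑' n, cesaroTerm hγ.le (c n) n) f ∈ HZero γ := by
  have h1 := hs.hasSum.mapL (ContinuousLinearMap.apply ℂ (HInfty γ) f)
  refine isClosed_hZero.mem_of_tendsto h1 (Eventually.of_forall fun s => ?_)
  refine (HZero γ).sum_mem fun n _ => ?_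
  rw [ContinuousLinearMap.apply_apply, cesaroTerm_apply]
  exact (HZero γ).smul_mem _ (monomialH_mem_hZero hγ n)

theorem isCompactOperator_tsum_cesaroTerm (hγ : 0 ≤ γ) {c : ℕ → ℂ}
    (hs : Summable fun n => cesaroTerm hγ (c n) n) :
    IsCompactOperator (∑' n, cesaroTerm hγ (c n) n : HInfty γ →L[ℂ] HInfty γ) := by
  refine isCompactOperator_of_tendsto hs.hasSum (Eventually.of_forall fun s => ?_)
  exact (compactOperator (RingHom.id ℂ) (HInfty γ) (HInfty γ)).sum_mem
    (t := s) (f := fun n => cesaroTerm hγ (c n) n)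
    fun n _ => isCompactOperator_cesaroTerm hγ (c n) n

end RankOne

/-! ### Comparison with Lebesgue measure -/

section LayerCake

/-- The superlevel sets of an increasing `φ` are intervals ending at `1`, exactly the sets on which
the Carleson condition compares `ν` with Lebesgue measure. -/
theorem lintegral_le_of_measure_Ico_le {ν : Measure ℝ} [IsFiniteMeasure ν] {K : ℝ} (hK : 0 ≤ K)
    (h : ∀ t ∈ Ico (0 : ℝ) 1, ν.real (Ico t 1) ≤ K * (1 - t)) {φ : ℝ → ℝ}
    (hφ : MonotoneOn φ (Ico 0 1)) (h0 : ∀ t ∈ Ico (0 : ℝ) 1, 0 ≤ φ t) :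
    ∫⁻ t in Ico (0 : ℝ) 1, ENNReal.ofReal (φ t) ∂ν
      ≤ ENNReal.ofReal K * ∫⁻ t in Ico (0 : ℝ) 1, ENNReal.ofReal (φ t) := by
  have hnn : ∀ m : Measure ℝ, 0 ≤ᵐ[m.restrict (Ico 0 1)] φ := fun m =>
    ae_restrict_of_forall_mem measurableSet_Ico h0
  rw [lintegral_eq_lintegral_meas_lt _ (hnn _) (aemeasurable_restrict_of_monotoneOn
      measurableSet_Ico hφ), lintegral_eq_lintegral_meas_lt _ (hnn _)
      (aemeasurable_restrict_of_monotoneOn measurableSet_Ico hφ),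
    ← lintegral_const_mul' _ _ ENNReal.ofReal_ne_top]
  refine lintegral_mono fun s => ?_
  simp only [Measure.restrict_apply' measurableSet_Ico]
  set A : Set ℝ := {a | s < φ a} ∩ Ico 0 1 with hA
  rcases A.eq_empty_or_nonempty with hAe | hne
  · simp [hAe]
  have hbdd : BddBelow A := ⟨0, fun a ha => ha.2.1⟩
  have ht1 : sInf A < 1 := by
    obtain ⟨a, ha⟩ := hne
    exact (csInf_le hbdd ha).trans_lt ha.2.2
  have ht0 : 0 ≤ sInf A := le_csInf hne fun a ha => ha.2.1
  -- Whether `A` contains its infimum is unknown: `ν` may have an atom there, so it is bounded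
  -- through the larger interval, while Lebesgue measure ignores the endpoint.
  have hsub : A ⊆ Ico (sInf A) 1 := fun a ha => ⟨csInf_le hbdd ha, ha.2.2⟩
  have hsup : Ioo (sInf A) 1 ⊆ A := by
    intro t ht
    obtain ⟨a, ha, hat⟩ := exists_lt_of_csInf_lt hne ht.1
    have ht' : t ∈ Ico (0 : ℝ) 1 := ⟨ht0.trans ht.1.le, ht.2⟩
    exact ⟨lt_of_lt_of_le ha.1 (hφ ha.2 ht' hat.le), ht'⟩
  calc ν A ≤ ν (Ico (sInf A) 1) := measure_mono hsub
    _ = ENNReal.ofReal (ν.real (Ico (sInf A) 1)) := (ofReal_measureReal).symm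
    _ ≤ ENNReal.ofReal (K * (1 - sInf A)) := ENNReal.ofReal_le_ofReal (h _ ⟨ht0, ht1⟩)
    _ = ENNReal.ofReal K * volume (Ioo (sInf A) 1) := by
      rw [ENNReal.ofReal_mul hK, Real.volume_Ioo]
    _ ≤ ENNReal.ofReal K * volume A := by gcongr

theorem integral_rpow_one_sub_add_le {γ δ : ℝ} (hγ : 0 < γ) (hδ : 0 < δ) :
    ∫ t in Ico (0 : ℝ) 1, (1 - t + δ) ^ (-γ - 1) ≤ δ ^ (-γ) / γ := by
  rw [setIntegral_congr_set Ico_ae_eq_Ioc, ← intervalIntegral.integral_of_le zero_le_one]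
  have hpos : ∀ t ∈ uIcc (0 : ℝ) 1, 0 < 1 - t + δ := by
    intro t ht
    rw [uIcc_of_le zero_le_one] at ht
    linarith [ht.2]
  have hd : ∀ t ∈ uIcc (0 : ℝ) 1,
      HasDerivAt (fun t => (1 - t + δ) ^ (-γ) / γ) ((1 - t + δ) ^ (-γ - 1)) t := by
    intro t ht
    have h1 : HasDerivAt (fun t : ℝ => 1 - t + δ) (-1) t := by
      simpa using ((hasDerivAt_id t).const_sub 1).add_const δ
    refine ((h1.rpow_const (p := -γ) (Or.inl (hpos t ht).ne')).div_const γ).congr_deriv ?_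
    field_simp
  rw [intervalIntegral.integral_eq_sub_of_hasDerivAt hd]
  · have : 0 ≤ (1 - 0 + δ) ^ (-γ) / γ := by positivity
    simp only [sub_self, zero_add]
    linarith
  · refine ContinuousOn.intervalIntegrable ?_
    exact ContinuousOn.rpow_const (by fun_prop) fun t ht => Or.inl (hpos t ht).ne'

end LayerCake

/-! ### Integral representation and the norm estimate -/

section Integral

theorem integrableOn_pow_Ico (μ : Measure ℝ) [IsFiniteMeasure μ] (n : ℕ) :
    IntegrableOn (fun t : ℝ => t ^ n) (Ico 0 1) μ :=
  Measure.integrableOn_of_bounded (M := 1) (measure_ne_top _ _) (by fun_prop)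
    (ae_restrict_of_forall_mem measurableSet_Ico fun t ht => by
      rw [Real.norm_of_nonneg (pow_nonneg ht.1 n)]
      exact pow_le_one₀ ht.1 ht.2.le)

theorem moment_nonneg (ν : Measure ℝ) (n : ℕ) : 0 ≤ moment ν n :=
  setIntegral_nonneg measurableSet_Ico fun _ ht => pow_nonneg ht.1 n

/-- Cauchy product of the Taylor series with the geometric series. -/
theorem tsum_partialSum_mul_pow {f : ℂ → ℂ} (hf : DifferentiableOn ℂ f (ball 0 1)) {w : ℂ}
    (hw : w ∈ ball (0 : ℂ) 1) :
    ∑' n, (∑ k ∈ Finset.range (n + 1), taylorCoeff f k) * w ^ n = f w / (1 - w) := by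
  have hw1 : ‖w‖ < 1 := mem_ball_zero_iff.1 hw
  have h1 := hasSum_taylorCoeff hf hw
  have h2 : Summable fun n => ‖w ^ n‖ := by
    simpa [norm_pow] using summable_geometric_of_lt_one (norm_nonneg w) hw1
  have h3 := tsum_mul_tsum_eq_tsum_sum_range_of_summable_norm h1.summable.norm h2
  rw [h1.tsum_eq, tsum_geometric_of_norm_lt_one hw1] at h3
  rw [div_eq_mul_inv, h3]
  refine tsum_congr fun n => ?_
  rw [Finset.sum_mul]
  refine Finset.sum_congr rfl fun k hk => ?_
  rw [mul_assoc, ← pow_add, Nat.add_sub_cancel' (Nat.lt_succ_iff.1 (Finset.mem_range.1 hk))]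

theorem real_mul_mem_ball {z : ℂ} (hz : z ∈ ball (0 : ℂ) 1) {t : ℝ} (ht : t ∈ Ico (0 : ℝ) 1) :
    (t : ℂ) * z ∈ ball (0 : ℂ) 1 := by
  rw [mem_ball_zero_iff] at hz ⊢
  rw [norm_mul, Complex.norm_of_nonneg ht.1]
  nlinarith [norm_nonneg z, ht.1, ht.2]

theorem cesaro_eq_integral (ν : Measure ℝ) [IsFiniteMeasure ν] {f : ℂ → ℂ}
    (hf : DifferentiableOn ℂ f (ball 0 1)) {z : ℂ} (hz : z ∈ ball (0 : ℂ) 1) :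
    cesaro ν f z = ∫ t in Ico (0 : ℝ) 1, f (t * z) / (1 - t * z) ∂ν := by
  set F : ℕ → ℝ → ℂ := fun n t =>
    (∑ k ∈ Finset.range (n + 1), taylorCoeff f k) * z ^ n * ((t ^ n : ℝ) : ℂ) with hF
  have hint : ∀ n, Integrable (F n) (ν.restrict (Ico 0 1)) := fun n =>
    (integrableOn_pow_Ico ν n).ofReal.const_mul _
  have hnorm : ∀ n, ∫ t in Ico (0 : ℝ) 1, ‖F n t‖ ∂ν
      = ‖(moment ν n : ℂ) * (∑ k ∈ Finset.range (n + 1), taylorCoeff f k) * z ^ n‖ := by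
    intro n
    have h1 : ∀ t ∈ Ico (0 : ℝ) 1, ‖F n t‖
        = ‖(∑ k ∈ Finset.range (n + 1), taylorCoeff f k) * z ^ n‖ * t ^ n := fun t ht => by
      rw [hF, norm_mul, Complex.norm_of_nonneg (pow_nonneg ht.1 n)]
    rw [setIntegral_congr_fun measurableSet_Ico h1, integral_const_mul, mul_assoc,
      norm_mul (moment ν n : ℂ), Complex.norm_of_nonneg (moment_nonneg ν n), mul_comm]
    rfl
  have h := hasSum_integral_of_summable_integral_norm hint
    ((summable_norm_cesaro ν hf hz).congr fun n => (hnorm n).symm)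
  rw [cesaro]
  calc _ = ∑' n, ∫ t in Ico (0 : ℝ) 1, F n t ∂ν := tsum_congr fun n => by
        rw [hF, integral_const_mul, integral_complex_ofReal]
        change _ = _ * (moment ν n : ℂ)
        ring
    _ = ∫ t in Ico (0 : ℝ) 1, ∑' n, F n t ∂ν := h.tsum_eq
    _ = _ := setIntegral_congr_fun measurableSet_Ico fun t ht => by
        rw [← tsum_partialSum_mul_pow hf (real_mul_mem_ball hz ht)]
        refine tsum_congr fun n => ?_
        rw [hF, mul_pow]
        push_cast
        ring

/-- The integrand is at most `‖f‖ * (1 - t * ‖z‖) ^ (-γ - 1)`, with `γ` from the growth of `f` and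
`1` from the kernel. Integrating over `t` regains one power, leaving `(1 - ‖z‖) ^ (-γ)`, which the
weight cancels. The bound is linear in `K`. -/
theorem weight_mul_norm_cesaro_le {ν : Measure ℝ} [IsFiniteMeasure ν] {K : ℝ} (hK : 0 ≤ K)
    (h : ∀ t ∈ Ico (0 : ℝ) 1, ν.real (Ico t 1) ≤ K * (1 - t)) {γ : ℝ} (hγ : 0 < γ)
    (f : HInfty γ) {z : ℂ} (hz : z ∈ ball (0 : ℂ) 1) :
    weight γ z * ‖cesaro ν f z‖ ≤ K * (2 ^ (γ + 1) / γ) * ‖f‖ := by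
  set δ : ℝ := 1 - ‖z‖ with hδ
  have hδ0 : 0 < δ := by linarith [mem_ball_zero_iff.1 hz]
  set B : ℝ := ‖f‖ * 2 ^ (γ + 1) with hB
  have hB0 : 0 ≤ B := by positivity
  set φ : ℝ → ℝ := fun t => B * (1 - t + δ) ^ (-γ - 1) with hφ
  have hpt : ∀ t ∈ Ico (0 : ℝ) 1, ‖f (t * z) / (1 - t * z)‖ ≤ φ t := by
    intro t ht
    have htz := real_mul_mem_ball hz ht
    have hn : ‖(t : ℂ) * z‖ = t * ‖z‖ := by rw [norm_mul, Complex.norm_of_nonneg ht.1]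
    -- Twice the difference of the two sides is `t * (1 - ‖z‖) + ‖z‖ * (1 - t)`. This halving
    -- produces the factor `2 ^ (γ + 1)`.
    have hlow : (1 - t + δ) / 2 ≤ 1 - t * ‖z‖ := by
      nlinarith [mul_nonneg (sub_nonneg.2 ht.2.le) (norm_nonneg z), mul_nonneg ht.1 hδ0.le]
    have hpos : 0 < (1 - t + δ) / 2 := by linarith [ht.2]
    have h1 : ‖f (t * z)‖ ≤ (1 - t * ‖z‖) ^ (-γ) * ‖f‖ := by
      simpa only [hn] using HInfty.norm_apply_le f htz
    have h2 : 1 - t * ‖z‖ ≤ ‖1 - (t : ℂ) * z‖ := by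
      have := norm_sub_norm_le (1 : ℂ) (t * z)
      rwa [norm_one, hn] at this
    have hp : 0 < 1 - t * ‖z‖ := hpos.trans_le hlow
    rw [norm_div]
    calc ‖f (t * z)‖ / ‖1 - (t : ℂ) * z‖ ≤ (1 - t * ‖z‖) ^ (-γ) * ‖f‖ / (1 - t * ‖z‖) := by
          gcongr
      _ = ‖f‖ * (1 - t * ‖z‖) ^ (-γ - 1) := by
          rw [Real.rpow_sub_one hp.ne']
          ring
      _ ≤ ‖f‖ * ((1 - t + δ) / 2) ^ (-γ - 1) := mul_le_mul_of_nonneg_left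
          (Real.rpow_le_rpow_of_nonpos hpos hlow (by linarith)) (norm_nonneg f)
      _ = φ t := by
          have : (2 : ℝ) ^ (γ + 1) = (2 ^ (-γ - 1))⁻¹ := by
            rw [← Real.rpow_neg zero_le_two]
            ring_nf
          rw [Real.div_rpow (by linarith [ht.2]) zero_le_two, hφ, hB, this]
          field_simp
  have hmono : MonotoneOn φ (Ico 0 1) := fun s hs t ht hst =>
    mul_le_mul_of_nonneg_left (Real.rpow_le_rpow_of_nonpos (by linarith [ht.2])
      (by linarith) (by linarith)) hB0
  have hφ0 : ∀ t ∈ Ico (0 : ℝ) 1, 0 ≤ φ t := fun t ht =>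
    mul_nonneg hB0 (Real.rpow_nonneg (by linarith [ht.2]) _)
  have hφint : IntegrableOn φ (Ico 0 1) := by
    refine (ContinuousOn.integrableOn_Icc ?_).mono_set Ico_subset_Icc_self
    refine ContinuousOn.const_mul ?_ _
    exact ContinuousOn.rpow_const (by fun_prop) fun t ht =>
      Or.inl (by linarith [ht.2] : (0 : ℝ) < 1 - t + δ).ne'
  have hmain : ‖cesaro ν f z‖ ≤ K * (B * (δ ^ (-γ) / γ)) := by
    have hR : 0 ≤ B * (δ ^ (-γ) / γ) := by positivity
    rw [cesaro_eq_integral ν f.2.1 hz, ← ENNReal.ofReal_le_ofReal_iff (by positivity)]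
    calc ENNReal.ofReal ‖∫ t in Ico (0 : ℝ) 1, f (t * z) / (1 - t * z) ∂ν‖
        ≤ ∫⁻ t in Ico (0 : ℝ) 1, ENNReal.ofReal ‖f (t * z) / (1 - t * z)‖ ∂ν := by
          simpa only [ofReal_norm] using enorm_integral_le_lintegral_enorm _
      _ ≤ ∫⁻ t in Ico (0 : ℝ) 1, ENNReal.ofReal (φ t) ∂ν :=
          setLIntegral_mono' measurableSet_Ico fun t ht => ENNReal.ofReal_le_ofReal (hpt t ht)
      _ ≤ ENNReal.ofReal K * ∫⁻ t in Ico (0 : ℝ) 1, ENNReal.ofReal (φ t) :=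
          lintegral_le_of_measure_Ico_le hK h hmono hφ0
      _ = ENNReal.ofReal (K * ∫ t in Ico (0 : ℝ) 1, φ t) := by
          rw [ENNReal.ofReal_mul hK, ofReal_integral_eq_lintegral_ofReal hφint
            (ae_restrict_of_forall_mem measurableSet_Ico hφ0)]
      _ ≤ ENNReal.ofReal (K * (B * (δ ^ (-γ) / γ))) := by
          refine ENNReal.ofReal_le_ofReal (mul_le_mul_of_nonneg_left ?_ hK)
          rw [integral_const_mul]
          exact mul_le_mul_of_nonneg_left (integral_rpow_one_sub_add_le hγ hδ0) hB0
  calc weight γ z * ‖cesaro ν f z‖ ≤ weight γ z * (K * (B * (δ ^ (-γ) / γ))) :=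
        mul_le_mul_of_nonneg_left hmain (weight_nonneg hz)
    _ = K * (2 ^ (γ + 1) / γ) * ‖f‖ := by
        have : 0 < δ ^ γ := Real.rpow_pos_of_pos hδ0 γ
        rw [weight, ← hδ, hB, Real.rpow_neg hδ0.le]
        field_simp

end Integral

/-! ### Moments: positivity, strict decrease, limit, splitting -/

section Moments

theorem setIntegral_Ico_pos {μ : Measure ℝ} (hpos : 0 < μ (Ioo (0 : ℝ) 1)) {φ : ℝ → ℝ}
    (hφ : IntegrableOn φ (Ico 0 1) μ) (h0 : ∀ t ∈ Ico (0 : ℝ) 1, 0 ≤ φ t)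
    (h1 : ∀ t ∈ Ioo (0 : ℝ) 1, 0 < φ t) : 0 < ∫ t in Ico (0 : ℝ) 1, φ t ∂μ := by
  rw [setIntegral_pos_iff_support_of_nonneg_ae
    (ae_restrict_of_forall_mem measurableSet_Ico h0) hφ]
  exact hpos.trans_le (measure_mono fun t ht => ⟨(h1 t ht).ne', Ioo_subset_Ico_self ht⟩)

theorem moment_pos {μ : Measure ℝ} [IsFiniteMeasure μ] (hpos : 0 < μ (Ioo (0 : ℝ) 1)) (n : ℕ) :
    0 < moment μ n :=
  setIntegral_Ico_pos hpos (integrableOn_pow_Ico μ n) (fun _ ht => pow_nonneg ht.1 n)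
    fun _ ht => pow_pos ht.1 n

/-- `t ^ n - t ^ (n + 1)` is positive on `(0,1)`, which carries mass; an atom at `0` alone would not
suffice. -/
theorem moment_strictAnti {μ : Measure ℝ} [IsFiniteMeasure μ]
    (hpos : 0 < μ (Ioo (0 : ℝ) 1)) : StrictAnti (moment μ) := by
  refine strictAnti_nat_of_succ_lt fun n => ?_
  rw [← sub_pos, moment, moment,
    ← integral_sub (integrableOn_pow_Ico μ n) (integrableOn_pow_Ico μ (n + 1))]
  refine setIntegral_Ico_pos hpos
    ((integrableOn_pow_Ico μ n).sub (integrableOn_pow_Ico μ (n + 1))) (fun t ht => ?_)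
    fun t ht => ?_
  · exact sub_nonneg.2 (pow_le_pow_of_le_one ht.1 ht.2.le n.le_succ)
  · exact sub_pos.2 (pow_lt_pow_right_of_lt_one₀ ht.1 ht.2 n.lt_succ_self)

theorem tendsto_moment (μ : Measure ℝ) [IsFiniteMeasure μ] :
    Tendsto (moment μ) atTop (𝓝 0) := by
  have h := tendsto_integral_of_dominated_convergence (μ := μ.restrict (Ico (0 : ℝ) 1))
    (F := fun (n : ℕ) (t : ℝ) => t ^ n) (f := fun _ => 0) (fun _ => 1)
    (fun n => by fun_prop) (integrable_const _)
    (fun n => ae_restrict_of_forall_mem measurableSet_Ico fun t ht => by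
      rw [Real.norm_of_nonneg (pow_nonneg ht.1 n)]
      exact pow_le_one₀ ht.1 ht.2.le)
    (ae_restrict_of_forall_mem measurableSet_Ico fun t ht =>
      tendsto_pow_atTop_nhds_zero_of_lt_one ht.1 ht.2)
  simpa [moment] using! h

theorem moment_restrict_add (μ : Measure ℝ) [IsFiniteMeasure μ] {ρ : ℝ} (h0 : 0 ≤ ρ)
    (h1 : ρ ≤ 1) (n : ℕ) :
    moment (μ.restrict (Ico 0 ρ)) n + moment (μ.restrict (Ico ρ 1)) n = moment μ n := by
  have hi := integrableOn_pow_Ico μ n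
  have hU : Ico (0 : ℝ) 1 = Ico 0 ρ ∪ Ico ρ 1 := (Ico_union_Ico_eq_Ico h0 h1).symm
  have hs1 : Ico (0 : ℝ) ρ ⊆ Ico 0 1 := Ico_subset_Ico_right h1
  have hs2 : Ico ρ (1 : ℝ) ⊆ Ico 0 1 := Ico_subset_Ico_left h0
  rw [moment, moment, moment, Measure.restrict_restrict measurableSet_Ico,
    Measure.restrict_restrict measurableSet_Ico, inter_eq_right.2 hs1, inter_eq_right.2 hs2,
    hU, setIntegral_union (Ico_disjoint_Ico_same) measurableSet_Ico (hi.mono_set hs1)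
      (hi.mono_set hs2)]

theorem norm_moment_restrict_le (μ : Measure ℝ) [IsFiniteMeasure μ] {ρ : ℝ} (h1 : ρ ≤ 1)
    (n : ℕ) : ‖(moment (μ.restrict (Ico 0 ρ)) n : ℂ)‖ ≤ μ.real (Ico 0 ρ) * ρ ^ n := by
  rw [Complex.norm_real, moment, Measure.restrict_restrict measurableSet_Ico,
    inter_eq_right.2 (Ico_subset_Ico_right h1), mul_comm]
  refine norm_setIntegral_le_of_norm_le_const (measure_lt_top _ _) fun t ht => ?_
  rw [Real.norm_of_nonneg (pow_nonneg ht.1 n)]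
  exact pow_le_pow_left₀ ht.1 ht.2.le n

end Moments

/-! ### Small Carleson constants near `1` -/

section Carleson

theorem exists_measure_Ico_le {μ : Measure ℝ}
    (hC : IsVanishingCarleson 1 μ ∨ ∃ s : ℝ, 1 < s ∧ IsCarleson s μ) {ε : ℝ} (hε : 0 < ε) :
    ∃ ρ ∈ Ioo (0 : ℝ) 1, ∀ t ∈ Ico ρ 1, μ.real (Ico t 1) ≤ ε * (1 - t) := by
  suffices h : ∀ᶠ t in 𝓝[<] (1 : ℝ), μ.real (Ico t 1) ≤ ε * (1 - t) by
    obtain ⟨a, ha, h⟩ := (mem_nhdsLT_iff_exists_Ioo_subset' zero_lt_one).1 h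
    have ha1 : a < 1 := ha
    -- The midpoint of `max a 0` and `1` is positive and lies strictly above `a`, so `[ρ,1)` lies
    -- inside `(a,1)`.
    refine ⟨(max a 0 + 1) / 2, ⟨?_, ?_⟩, fun t ht => h ⟨?_, ht.2⟩⟩
    · linarith [le_max_right a 0]
    · linarith [max_lt ha1 zero_lt_one]
    · linarith [ht.1, le_max_left a 0, max_lt ha1 zero_lt_one]
  rcases hC with hv | ⟨s, hs, C, hC⟩
  · filter_upwards [isLittleO_iff.1 hv hε, self_mem_nhdsWithin] with t ht ht1
    have ht1' : 0 < 1 - t := sub_pos.2 ht1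
    rwa [Real.rpow_one, Real.norm_of_nonneg measureReal_nonneg,
      Real.norm_of_nonneg ht1'.le] at ht
  · have hlim : Tendsto (fun t : ℝ => C * (1 - t) ^ (s - 1)) (𝓝[<] 1) (𝓝 0) := by
      have : ContinuousAt (fun t : ℝ => C * (1 - t) ^ (s - 1)) 1 :=
        continuousAt_const.mul (ContinuousAt.rpow_const (by fun_prop) (Or.inr (by linarith)))
      have h := this.tendsto.mono_left (nhdsWithin_le_nhds (s := Iio 1))
      simpa [Real.zero_rpow (sub_pos.2 hs).ne'] using h
    filter_upwards [hlim.eventually (ge_mem_nhds hε),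
      Ioo_mem_nhdsLT (zero_lt_one (α := ℝ))] with t ht ht01
    have h1 : 0 < 1 - t := sub_pos.2 ht01.2
    refine (hC t ⟨ht01.1.le, ht01.2⟩).trans ?_
    calc C * (1 - t) ^ s = C * (1 - t) ^ (s - 1) * (1 - t) := by
          rw [Real.rpow_sub_one h1.ne']
          field_simp
      _ ≤ ε * (1 - t) := mul_le_mul_of_nonneg_right ht h1.le

end Carleson

/-! ### Boundedness and compactness of `C_μ` -/

section Operator

variable {γ : ℝ}

theorem hasSum_cesaro (μ : Measure ℝ) [IsFiniteMeasure μ] {f : ℂ → ℂ}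
    (hf : DifferentiableOn ℂ f (ball 0 1)) {z : ℂ} (hz : z ∈ ball (0 : ℂ) 1) :
    HasSum (fun n : ℕ => (moment μ n : ℂ) * (∑ k ∈ Finset.range (n + 1), taylorCoeff f k) * z ^ n)
      (cesaro μ f z) :=
  (summable_norm_cesaro μ hf hz).of_norm.hasSum

theorem cesaro_add (μ : Measure ℝ) [IsFiniteMeasure μ] (f g : HInfty γ) {z : ℂ}
    (hz : z ∈ ball (0 : ℂ) 1) :
    cesaro μ (f + g : HInfty γ) z = cesaro μ f z + cesaro μ g z := by
  refine (hasSum_cesaro μ (f + g : HInfty γ).2.1 hz).unique ?_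
  refine ((hasSum_cesaro μ f.2.1 hz).add (hasSum_cesaro μ g.2.1 hz)).congr_fun fun n => ?_
  simp only [taylorCoeff_hInfty_add, Finset.sum_add_distrib]
  ring

theorem cesaro_smul (μ : Measure ℝ) [IsFiniteMeasure μ] (c : ℂ) (f : HInfty γ) {z : ℂ}
    (hz : z ∈ ball (0 : ℂ) 1) : cesaro μ (c • f : HInfty γ) z = c * cesaro μ f z := by
  refine (hasSum_cesaro μ (c • f : HInfty γ).2.1 hz).unique ?_
  refine ((hasSum_cesaro μ f.2.1 hz).mul_left c).congr_fun fun n => ?_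
  simp only [taylorCoeff_hInfty_smul, ← Finset.mul_sum]
  ring

theorem cesaro_restrict_add (μ : Measure ℝ) [IsFiniteMeasure μ] {ρ : ℝ} (h0 : 0 ≤ ρ)
    (h1 : ρ ≤ 1) {f : ℂ → ℂ} (hf : DifferentiableOn ℂ f (ball 0 1)) {z : ℂ}
    (hz : z ∈ ball (0 : ℂ) 1) :
    cesaro (μ.restrict (Ico 0 ρ)) f z + cesaro (μ.restrict (Ico ρ 1)) f z = cesaro μ f z := by
  refine HasSum.unique ?_ (hasSum_cesaro μ hf hz)
  refine ((hasSum_cesaro (μ.restrict (Ico 0 ρ)) hf hz).add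
    (hasSum_cesaro (μ.restrict (Ico ρ 1)) hf hz)).congr_fun fun n => ?_
  rw [← moment_restrict_add μ h0 h1 n]
  push_cast
  ring

/-- `C_μ` is a limit of compact operators with values in `H^0_{v_γ}`. -/
theorem exists_compact_approx_cesaro {μ : Measure ℝ} [IsFiniteMeasure μ]
    (hC : IsVanishingCarleson 1 μ ∨ ∃ s : ℝ, 1 < s ∧ IsCarleson s μ) (hγ : 0 < γ)
    {ε : ℝ} (hε : 0 < ε) :
    ∃ S : HInfty γ →L[ℂ] HInfty γ, IsCompactOperator S ∧ (∀ f, S f ∈ HZero γ) ∧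
      ∀ f : HInfty γ, ∀ z ∈ ball (0 : ℂ) 1, weight γ z * ‖cesaro μ f z - S f z‖ ≤ ε * ‖f‖ := by
  -- `A` is the constant of `weight_mul_norm_cesaro_le`; a tail with Carleson constant `ε / A`
  -- contributes at most `ε`.
  set A : ℝ := 2 ^ (γ + 1) / γ with hA
  have hA0 : 0 < A := by positivity
  obtain ⟨ρ, ⟨hρ0, hρ1⟩, hρ⟩ := exists_measure_Ico_le hC (div_pos hε hA0)
  have hs := summable_cesaroTerm hγ.le hρ0 hρ1 (norm_moment_restrict_le μ hρ1.le)
  refine ⟨_, isCompactOperator_tsum_cesaroTerm hγ.le hs, tsum_cesaroTerm_mem_hZero hγ hs,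
    fun f z hz => ?_⟩
  have hK : ∀ t ∈ Ico (0 : ℝ) 1, (μ.restrict (Ico ρ 1)).real (Ico t 1) ≤ ε / A * (1 - t) := by
    intro t ht
    rw [measureReal_restrict_apply measurableSet_Ico, Ico_inter_Ico, min_self]
    refine (hρ (max t ρ) ⟨le_max_right _ _, max_lt ht.2 hρ1⟩).trans ?_
    exact mul_le_mul_of_nonneg_left (by linarith [le_max_left t ρ]) (by positivity)
  have h := weight_mul_norm_cesaro_le (by positivity) hK hγ f hz
  rw [← hA, div_mul_cancel₀ _ hA0.ne'] at h
  rw [tsum_cesaroTerm_apply hγ.le hs f hz]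
  change weight γ z * ‖cesaro μ f z - cesaro (μ.restrict (Ico 0 ρ)) f z‖ ≤ _
  rwa [← cesaro_restrict_add μ hρ0.le hρ1.le f.2.1 hz, add_sub_cancel_left]

theorem exists_cesaroCLM {μ : Measure ℝ} [IsFiniteMeasure μ]
    (hC : IsVanishingCarleson 1 μ ∨ ∃ s : ℝ, 1 < s ∧ IsCarleson s μ) (hγ : 0 < γ) :
    ∃ T : HInfty γ →L[ℂ] HInfty γ, IsCompactOperator T ∧ (∀ f, T f ∈ HZero γ) ∧
      ∀ f : HInfty γ, ∀ z ∈ ball (0 : ℂ) 1, T f z = cesaro μ f z := by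
  -- Approximation within `1` by a bounded operator already gives boundedness of `C_μ`.
  obtain ⟨S, -, -, hS⟩ := exists_compact_approx_cesaro (γ := γ) hC hγ one_pos
  have hbound : ∀ f : HInfty γ, ∀ z ∈ ball (0 : ℂ) 1,
      weight γ z * ‖cesaro μ f z‖ ≤ (1 + ‖S‖) * ‖f‖ := by
    intro f z hz
    have h1 := hS f z hz
    have h2 : weight γ z * ‖S f z‖ ≤ ‖S‖ * ‖f‖ :=
      (weight_mul_le_norm (S f) ⟨z, hz⟩).trans (S.le_opNorm f)
    have h3 : ‖cesaro μ f z‖ ≤ ‖cesaro μ f z - S f z‖ + ‖S f z‖ := by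
      simpa using norm_add_le (cesaro μ f z - S f z) (S f z)
    have h4 := mul_le_mul_of_nonneg_left h3 (weight_nonneg (γ := γ) hz)
    linarith
  obtain ⟨C, hCz⟩ : ∃ C : HInfty γ → HInfty γ, ∀ f, ∀ z ∈ ball (0 : ℂ) 1, C f z = cesaro μ f z :=
    ⟨fun f => HInfty.mk (cesaro μ f)
      (differentiableOn_of_hasSum fun z hz => hasSum_cesaro μ f.2.1 hz) _ (hbound f),
      fun _ _ hz => HInfty.mk_apply hz⟩
  let T : HInfty γ →L[ℂ] HInfty γ := LinearMap.mkContinuous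
    { toFun := C
      map_add' := fun f g => HInfty.ext fun z hz => by
        change _ = C f z + C g z
        rw [hCz _ z hz, hCz _ z hz, hCz _ z hz, cesaro_add μ f g hz]
      map_smul' := fun c f => HInfty.ext fun z hz => by
        change _ = c * C f z
        rw [hCz _ z hz, hCz _ z hz, cesaro_smul μ c f hz] }
    (1 + ‖S‖) fun f => HInfty.norm_le fun z hz => by
      change weight γ z * ‖C f z‖ ≤ _
      rw [hCz _ z hz]
      exact hbound f z hz
  have hT : ∀ f : HInfty γ, ∀ z ∈ ball (0 : ℂ) 1, T f z = cesaro μ f z := hCz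
  choose V hVc hV0 hV using fun n : ℕ =>
    exists_compact_approx_cesaro (γ := γ) hC hγ (Nat.one_div_pos_of_nat (α := ℝ) (n := n))
  have hlim : Tendsto V atTop (𝓝 T) := by
    rw [tendsto_iff_norm_sub_tendsto_zero]
    refine squeeze_zero (fun _ => norm_nonneg _) (fun n => ?_)
      tendsto_one_div_add_atTop_nhds_zero_nat
    refine ContinuousLinearMap.opNorm_le_bound _ Nat.one_div_pos_of_nat.le fun f =>
      HInfty.norm_le fun z hz => ?_
    rw [_root_.sub_apply, HInfty.sub_apply, hT f z hz, norm_sub_rev]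
    exact hV n f z hz
  refine ⟨T, isCompactOperator_of_tendsto hlim (Eventually.of_forall hVc), fun f => ?_, hT⟩
  refine isClosed_hZero.mem_of_tendsto
    (((ContinuousLinearMap.apply ℂ (HInfty γ) f).continuous.tendsto T).comp hlim)
    (Eventually.of_forall fun n => hV0 n f)

end Operator

/-! ### The spectra of `C_μ` on both spaces -/

theorem proposition3p10 (μ : MeasureTheory.Measure ℝ) [MeasureTheory.IsFiniteMeasure μ]
    (hμ : μ (Set.Ico (0 : ℝ) 1)ᶜ = 0) (hpos : 0 < μ (Set.Ioo (0 : ℝ) 1))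
    (hC : IsVanishingCarleson 1 μ ∨ ∃ s : ℝ, 1 < s ∧ IsCarleson s μ)
    (γ : ℝ) (hγ : 0 < γ) :
    ∃ (T : HInfty γ →L[ℂ] HInfty γ) (T₀ : HZero γ →L[ℂ] HZero γ),
      (∀ f : HInfty γ, ∀ z ∈ Metric.ball (0 : ℂ) 1, T f z = cesaro μ f z) ∧
      (∀ f : HZero γ, ∀ z ∈ Metric.ball (0 : ℂ) 1,
        (T₀ f : HInfty γ) z = cesaro μ (f : HInfty γ) z) ∧
      pointSpectrum T = Set.range (fun n : ℕ => (moment μ n : ℂ)) ∧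
      pointSpectrum T₀ = Set.range (fun n : ℕ => (moment μ n : ℂ)) ∧
      spectrum ℂ T = Set.range (fun n : ℕ => (moment μ n : ℂ)) ∪ {0} ∧
      spectrum ℂ T₀ = Set.range (fun n : ℕ => (moment μ n : ℂ)) ∪ {0} := by
  obtain ⟨T, hTc, hT0, hT⟩ := exists_cesaroCLM (μ := μ) hC hγ
  -- `T` maps all of `H^∞` into `H^0`; since `H^0` is closed, the restriction remains compact with
  -- codomain `H^0`.
  let T₀ : HZero γ →L[ℂ] HZero γ :=
    (T.comp (HZero γ).subtypeL).codRestrict (HZero γ) fun f => hT0 f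
  have hT₀c : IsCompactOperator T₀ :=
    (hTc.comp_clm (HZero γ).subtypeL).codRestrict (fun f => hT0 f) isClosed_hZero
  have hc0 : ∀ n, (moment μ n : ℂ) ≠ 0 := fun n =>
    Complex.ofReal_ne_zero.2 (moment_pos hpos n).ne'
  have hinj : Function.Injective fun n => (moment μ n : ℂ) :=
    Complex.ofReal_injective.comp (moment_strictAnti hpos).injective
  have hlim : Tendsto (fun n => (moment μ n : ℂ)) atTop (𝓝 0) := by
    simpa using! (Complex.continuous_ofReal.tendsto 0).comp (tendsto_moment μ)
  have hcoeff : ∀ (f : HInfty γ) (n : ℕ), taylorCoeff (T f) n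
      = (moment μ n : ℂ) * ∑ k ∈ Finset.range (n + 1), taylorCoeff f k := fun f n =>
    taylorCoeff_eq_of_hasSum (b := fun n => (moment μ n : ℂ) *
      ∑ k ∈ Finset.range (n + 1), taylorCoeff f k) (fun z hz => by
        rw [hT f z hz]
        exact hasSum_cesaro μ f.2.1 hz) n
  obtain ⟨hp, hs⟩ := spectra_of_triangular hTc hc0 hinj hlim
    (a := fun n => (taylorCoeffCLM γ n : HInfty γ →ₗ[ℂ] ℂ))
    (fun f hf => HInfty.taylorCoeff_eq_zero hf) hcoeff (e := monomialH hγ.le)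
    (taylorCoeff_monomialH hγ.le)
  obtain ⟨hp₀, hs₀⟩ := spectra_of_triangular hT₀c hc0 hinj hlim
    (a := fun n => (taylorCoeffCLM γ n : HInfty γ →ₗ[ℂ] ℂ).comp (HZero γ).subtype)
    (fun f hf => Subtype.ext (HInfty.taylorCoeff_eq_zero hf)) (fun f => hcoeff f)
    (e := fun n => ⟨monomialH hγ.le n, monomialH_mem_hZero hγ n⟩)
    (taylorCoeff_monomialH hγ.le)
  exact ⟨T, T₀, hT, fun f => hT f, hp, hp₀, hs, hs₀⟩
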